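/- **Corollary 5.2 (Extremal distribution for optimal estimator).** Let $p\ge 1$, let $\rho>0$, and let $\widehat\Sigma\in\mathbb R^{p\times p}$ be symmetric positive semidefinite with spectral decomposition $\widehat\Sigma=\sum_{i=1}^p\lambda_i v_iv_i^\top$, where $v_1,\dots,v_p$ are orthonormal. Let $\mathcal P_\rho$ be the set of all (possibly degenerate) normal distributions $\mathcal N(0,S)$ on $\mathbb R^p$, $S\succeq 0$, whose type-2 Wasserstein distance (with respect to the Euclidean norm) to $\mathcal N(0,\widehat\Sigma)$ is at most $\rho$. For $X\succ 0$ put $$g(\widehat\Sigma,X)=\sup_{\mathbb Q\in\mathcal P_\rho}\mathbb E^{\mathbb Q}\big[\xi^\top X\xi\big],$$ and consider, without sparsity constraints, the robust estimation problem $$\inf_{X\succ 0}\ \big\{-\log\det X+g(\widehat\Sigma,X)\big\}.\tag{1}$$ The equation $$\Big(\rho^2-\tfrac12\sum_{i=1}^p\lambda_i\Big)\gamma-p+\tfrac12\sum_{i=1}^p\sqrt{\lambda_i^2\gamma^2+4\lambda_i\gamma}=0$$ has exactly one solution $\gamma^\star>0$. Put $$X^\star=\sum_{i=1}^p x_i^\star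 v_iv_i^\top,\qquad x_i^\star=\gamma^\star\Big[1-\tfrac12\Big(\sqrt{\lambda_i^2(\gamma^\star)^2+4\lambda_i\gamma^\star}-\lambda_i\gamma^\star\Big)\Big].$$ Then $X^\star\succ 0$ is the unique minimizer of (1). If $\widehat\Sigma\succ 0$, then $(X^\star,\gamma^\star)$ is moreover the unique minimizer of $$\inf_{X,\gamma}\Big\{-\log\det X+\gamma\big(\rho^2-\operatorname{Tr}\widehat\Sigma\big)+\gamma^2\operatorname{Tr}\big((\gamma I-X)^{-1}\widehat\Sigma\big)\ :\ \gamma I\succ X\succ 0\Big\}.$$ For every $\widehat\Sigma\succeq 0$, singular or not, the supremum $g(\widehat\Sigma,X^\star)$ is attained by the normal distribution $\mathbb Q^\star=\mathcal N(0,S^\star)$, that is, $\mathbb Q^\star\in\mathcal P_\rho$ and $\mathbb E^{\mathbb Q^\star}[\xi^\top X^\star\xi]=g(\widehat\Sigma,X^\star)$, where the positive semidefinite matrix $S^\star$ is $$S^\star=\sum_{i=1}^p s_i^\star v_iv_i^\top,\qquad s_i^\star=\begin{cases}(\gamma^\star)^2\lambda_i(\gamma^\star-x_i^\star)^{-2}&\text{if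 }\lambda_i>0,\\(\gamma^\star)^{-1}&\text{if }\lambda_i=0.\end{cases}$$ -/

import Mathlib

open MeasureTheory ProbabilityTheory
open scoped ENNReal Matrix

noncomputable section

namespace WassersteinShrinkage

variable {p : ℕ}

/-- Joint distributions of two random vectors with marginals `P₁` and `P₂`. -/
def couplings (P₁ P₂ : Measure (EuclideanSpace ℝ (Fin p))) :
    Set (Measure (EuclideanSpace ℝ (Fin p) × EuclideanSpace ℝ (Fin p))) :=
  {π | π.map Prod.fst = P₁ ∧ π.map Prod.snd = P₂}

/-- The type-2 Wasserstein distance for the Euclidean norm; it is valued in `[0, ∞]` and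
finite for distributions with finite second moments. -/
def wasserstein (P₁ P₂ : Measure (EuclideanSpace ℝ (Fin p))) : ℝ≥0∞ :=
  ⨅ π ∈ couplings P₁ P₂, (∫⁻ z, ‖z.1 - z.2‖ₑ ^ 2 ∂π) ^ (1 / 2 : ℝ)

/-- All (possibly degenerate) zero-mean normal distributions whose Wasserstein distance to
`N(0, Sig)` is at most `ρ`. -/
def ambiguitySet (ρ : ℝ) (Sig : Matrix (Fin p) (Fin p) ℝ) :
    Set (Measure (EuclideanSpace ℝ (Fin p))) :=
  {Q | (∃ S : Matrix (Fin p) (Fin p) ℝ, S.PosSemidef ∧ Q = multivariateGaussian 0 S) ∧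
    wasserstein Q (multivariateGaussian 0 Sig) ≤ ENNReal.ofReal ρ}

/-- The expectation of `⟨ξ ξᵀ, X⟩ = ξᵀ X ξ` under `Q`. -/
def expectedQuadratic (Q : Measure (EuclideanSpace ℝ (Fin p)))
    (X : Matrix (Fin p) (Fin p) ℝ) : ℝ :=
  ∫ ξ, ξ.ofLp ⬝ᵥ (X *ᵥ ξ.ofLp) ∂Q

/-- The worst-case expectation `g(Sig, X)`, as an extended real supremum. -/
def worstCase (ρ : ℝ) (Sig X : Matrix (Fin p) (Fin p) ℝ) : EReal :=
  ⨆ Q ∈ ambiguitySet ρ Sig, (expectedQuadratic Q X : EReal)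

/-- The objective function of the distributionally robust estimation problem. -/
def robustObjective (ρ : ℝ) (Sig X : Matrix (Fin p) (Fin p) ℝ) : EReal :=
  ((-Real.log X.det : ℝ) : EReal) + worstCase ρ Sig X

/-- `X` is the unique minimizer of the distributionally robust estimation problem over all
positive definite matrices. -/
def IsUniqueRobustMinimizer (ρ : ℝ) (Sig X : Matrix (Fin p) (Fin p) ℝ) : Prop :=
  X.PosDef ∧ ∀ Y : Matrix (Fin p) (Fin p) ℝ, Y.PosDef → Y ≠ X →
    robustObjective ρ Sig X < robustObjective ρ Sig Y

/-- The feasible set `γ I ≻ X ≻ 0` of the convex reformulation. -/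
def convexFeasible (p : ℕ) : Set (Matrix (Fin p) (Fin p) ℝ × ℝ) :=
  {z | z.1.PosDef ∧ (z.2 • (1 : Matrix (Fin p) (Fin p) ℝ) - z.1).PosDef}

/-- The objective function
`-log det X + γ (ρ² - Tr Sig) + γ² ⟨(γ I - X)⁻¹, Sig⟩` of the convex reformulation. -/
def convexObjective (ρ : ℝ) (Sig : Matrix (Fin p) (Fin p) ℝ)
    (z : Matrix (Fin p) (Fin p) ℝ × ℝ) : ℝ :=
  -Real.log z.1.det + z.2 * (ρ ^ 2 - Sig.trace) +
    z.2 ^ 2 * (((z.2 • (1 : Matrix (Fin p) (Fin p) ℝ) - z.1)⁻¹)ᵀ * Sig).trace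

/-- `z = (X, γ)` is the unique minimizer of the convex reformulation. -/
def IsUniqueConvexMinimizer (ρ : ℝ) (Sig : Matrix (Fin p) (Fin p) ℝ)
    (z : Matrix (Fin p) (Fin p) ℝ × ℝ) : Prop :=
  z ∈ convexFeasible p ∧ ∀ w ∈ convexFeasible p, w ≠ z →
    convexObjective ρ Sig z < convexObjective ρ Sig w

/-- The matrix `∑ i, c i • v i (v i)ᵀ`. -/
def spectralSum (c : Fin p → ℝ) (v : Fin p → EuclideanSpace ℝ (Fin p)) :
    Matrix (Fin p) (Fin p) ℝ :=
  ∑ i, c i • Matrix.vecMulVec (v i).ofLp (v i).ofLp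

/-- `γ` is a positive solution of the algebraic equation for the dual variable. -/
def SolvesDualEquation (ρ : ℝ) (lam : Fin p → ℝ) (γ : ℝ) : Prop :=
  0 < γ ∧ (ρ ^ 2 - 1 / 2 * ∑ i, lam i) * γ - p +
    1 / 2 * ∑ i, Real.sqrt (lam i ^ 2 * γ ^ 2 + 4 * lam i * γ) = 0

/-- The eigenvalue of the optimal estimator that belongs to the eigenvalue `l` of `Sig`. -/
def estimatorEigenvalue (γ l : ℝ) : ℝ :=
  γ * (1 - 1 / 2 * (Real.sqrt (l ^ 2 * γ ^ 2 + 4 * l * γ) - l * γ))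

/-- The optimal estimator `X*`. -/
def estimator (γ : ℝ) (lam : Fin p → ℝ) (v : Fin p → EuclideanSpace ℝ (Fin p)) :
    Matrix (Fin p) (Fin p) ℝ :=
  spectralSum (fun i => estimatorEigenvalue γ (lam i)) v

/-- The eigenvalue of the extremal covariance matrix that belongs to the eigenvalue `l`
of `Sig`. -/
def extremalEigenvalue (γ l : ℝ) : ℝ :=
  if 0 < l then γ ^ 2 * l / (γ - estimatorEigenvalue γ l) ^ 2 else γ⁻¹

/-- The extremal covariance matrix `S*`. -/
def extremalCovariance (γ : ℝ) (lam : Fin p → ℝ) (v : Fin p → EuclideanSpace ℝ (Fin p)) :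
    Matrix (Fin p) (Fin p) ℝ :=
  spectralSum (fun i => extremalEigenvalue γ (lam i)) v

/-- The supremum that defines the worst-case expectation at `X` is attained by `Q`. -/
def AttainsWorstCase (ρ : ℝ) (Sig X : Matrix (Fin p) (Fin p) ℝ)
    (Q : Measure (EuclideanSpace ℝ (Fin p))) : Prop :=
  Q ∈ ambiguitySet ρ Sig ∧ (expectedQuadratic Q X : EReal) = worstCase ρ Sig X

end WassersteinShrinkage

end

/-! The pair (X*, N(0, S*)) is a saddle point. For each eigenvalue l, let u in [0, 1) be the
nonnegative root of u² = lγ(1 - u) (`sqrtRatio`). Then x = γ(1 - u), s = 1/x and √l = u√s, so S* X*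
= I, and the dual equation reads ρ²γ = Σ(1 - u), which says that Tr (√S* - √Sig)² = ρ².

Nature's side: coupling both Gaussians to one standard normal vector shows that N(0, S*) lies in the
ambiguity set (`extremal_mem_ambiguitySet`). Conversely, weak duality along any coupling bounds
every expectation at X* by γρ² + Σu = p (`expectedQuadratic_estimator_le`), and N(0, S*) reaches p.

The estimator's side: g(Y) ≥ Tr(S* Y) for every Y ≻ 0, and -log det Y + Tr(S* Y) has the unique
minimizer (S*)⁻¹ = X* (`neg_log_det_estimator_add_lt`). As equality holds at X*, the robust problem
is solved, with no need for a formula for g elsewhere.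

The convex objective equals -log det X + Tr(S* X) plus a nonnegative residual
(`convexObjective_eq`). The residual vanishes at (X*, γ*) and is positive at (X*, γ) for other
feasible γ. -/

noncomputable section

namespace WassersteinShrinkage

/-! ### Matrices that are diagonal in a given orthonormal basis -/

section SpectralSum

variable {p : ℕ} {v : Fin p → EuclideanSpace ℝ (Fin p)}

/-- The matrix whose columns are the given vectors. -/
def columnMatrix (v : Fin p → EuclideanSpace ℝ (Fin p)) : Matrix (Fin p) (Fin p) ℝ :=
  Matrix.of fun i j => v j i

lemma spectralSum_eq (c : Fin p → ℝ) (v : Fin p → EuclideanSpace ℝ (Fin p)) :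
    spectralSum c v = columnMatrix v * Matrix.diagonal c * (columnMatrix v)ᵀ := by
  ext i j
  rw [Matrix.mul_apply]
  simp only [spectralSum, Matrix.sum_apply, Matrix.smul_apply, Matrix.vecMulVec_apply,
    Matrix.mul_diagonal, columnMatrix, Matrix.of_apply, Matrix.transpose_apply,
    smul_eq_mul]
  exact Finset.sum_congr rfl fun k _ => by ring

lemma columnMatrix_transpose_mul_self (hv : Orthonormal ℝ v) :
    (columnMatrix v)ᵀ * columnMatrix v = 1 := by
  ext i j
  have h := orthonormal_iff_ite.1 hv i j
  simp only [PiLp.inner_apply, RCLike.inner_apply, conj_trivial] at h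
  simp only [Matrix.mul_apply, columnMatrix, Matrix.of_apply, Matrix.transpose_apply,
    Matrix.one_apply]
  rw [← h]
  exact Finset.sum_congr rfl fun k _ => mul_comm _ _

lemma columnMatrix_mul_transpose_self (hv : Orthonormal ℝ v) :
    columnMatrix v * (columnMatrix v)ᵀ = 1 :=
  mul_eq_one_comm.1 (columnMatrix_transpose_mul_self hv)

lemma spectralSum_mul (hv : Orthonormal ℝ v) (c d : Fin p → ℝ) :
    spectralSum c v * spectralSum d v = spectralSum (fun i => c i * d i) v := by
  simp only [spectralSum_eq]
  calc _ = columnMatrix v * Matrix.diagonal c * ((columnMatrix v)ᵀ * columnMatrix v) *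
        Matrix.diagonal d * (columnMatrix v)ᵀ := by simp only [Matrix.mul_assoc]
    _ = _ := by
      rw [columnMatrix_transpose_mul_self hv, Matrix.mul_one, Matrix.mul_assoc (columnMatrix v),
        Matrix.diagonal_mul_diagonal]

lemma spectralSum_one (hv : Orthonormal ℝ v) : spectralSum (fun _ => 1) v = 1 := by
  rw [spectralSum_eq, Matrix.diagonal_one, Matrix.mul_one, columnMatrix_mul_transpose_self hv]

lemma spectralSum_sub (c d : Fin p → ℝ) :
    spectralSum c v - spectralSum d v = spectralSum (fun i => c i - d i) v := by
  simp [spectralSum, sub_smul]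

lemma smul_spectralSum (a : ℝ) (c : Fin p → ℝ) :
    a • spectralSum c v = spectralSum (fun i => a * c i) v := by
  simp [spectralSum, Finset.smul_sum, smul_smul]

lemma smul_one_eq_spectralSum (hv : Orthonormal ℝ v) (a : ℝ) :
    a • (1 : Matrix (Fin p) (Fin p) ℝ) = spectralSum (fun _ => a) v := by
  rw [← spectralSum_one hv, smul_spectralSum]
  simp

lemma spectralSum_transpose (c : Fin p → ℝ) : (spectralSum c v)ᵀ = spectralSum c v := by
  simp [spectralSum_eq, Matrix.transpose_mul, Matrix.mul_assoc]

lemma trace_spectralSum (hv : Orthonormal ℝ v) (c : Fin p → ℝ) :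
    (spectralSum c v).trace = ∑ i, c i := by
  rw [spectralSum_eq, Matrix.trace_mul_comm, ← Matrix.mul_assoc,
    columnMatrix_transpose_mul_self hv, Matrix.one_mul, Matrix.trace_diagonal]

lemma dotProduct_spectralSum_mulVec (c : Fin p → ℝ) (x : EuclideanSpace ℝ (Fin p)) :
    x.ofLp ⬝ᵥ (spectralSum c v *ᵥ x.ofLp) = ∑ i, c i * inner ℝ (v i) x ^ 2 := by
  simp only [spectralSum, Matrix.sum_mulVec, dotProduct_sum, Matrix.smul_mulVec,
    Matrix.vecMulVec_mulVec, dotProduct_smul]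
  refine Finset.sum_congr rfl fun i _ => ?_
  have h : inner ℝ (v i) x = (v i).ofLp ⬝ᵥ x.ofLp := by
    simp [PiLp.inner_apply, dotProduct, mul_comm]
  rw [h, dotProduct_comm x.ofLp]
  simp only [MulOpposite.smul_eq_mul_unop, MulOpposite.unop_op, smul_eq_mul]
  ring

lemma sum_inner_sq_eq_norm_sq (hv : Orthonormal ℝ v) (x : EuclideanSpace ℝ (Fin p)) :
    ∑ i, inner ℝ (v i) x ^ 2 = ‖x‖ ^ 2 := by
  have h := dotProduct_spectralSum_mulVec (v := v) (fun _ => 1) x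
  rw [spectralSum_one hv, Matrix.one_mulVec] at h
  simp only [one_mul] at h
  rw [← h, EuclideanSpace.real_norm_sq_eq]
  simp [dotProduct, sq]

lemma posSemidef_spectralSum {c : Fin p → ℝ} (hc : ∀ i, 0 ≤ c i) :
    (spectralSum c v).PosSemidef := by
  rw [spectralSum_eq, ← Matrix.conjTranspose_eq_transpose_of_trivial]
  exact (Matrix.PosSemidef.diagonal hc).mul_mul_conjTranspose_same _

lemma posDef_spectralSum (hv : Orthonormal ℝ v) {c : Fin p → ℝ} (hc : ∀ i, 0 < c i) :
    (spectralSum c v).PosDef := by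
  rw [spectralSum_eq, ← Matrix.conjTranspose_eq_transpose_of_trivial]
  refine (Matrix.PosDef.diagonal hc).mul_mul_conjTranspose_same ?_
  refine Function.LeftInverse.injective (g := fun x => x ᵥ* (columnMatrix v)ᵀ) fun x => ?_
  simp [Matrix.vecMul_vecMul, columnMatrix_mul_transpose_self hv]

lemma dotProduct_spectralSum_mulVec_self (hv : Orthonormal ℝ v) (c : Fin p → ℝ) (i : Fin p) :
    (v i).ofLp ⬝ᵥ (spectralSum c v *ᵥ (v i).ofLp) = c i := by
  rw [dotProduct_spectralSum_mulVec]
  simp [orthonormal_iff_ite.1 hv]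

lemma nonneg_of_posSemidef_spectralSum (hv : Orthonormal ℝ v) {c : Fin p → ℝ}
    (h : (spectralSum c v).PosSemidef) (i : Fin p) : 0 ≤ c i := by
  have := h.dotProduct_mulVec_nonneg (v i).ofLp
  rwa [star_trivial, dotProduct_spectralSum_mulVec_self hv] at this

lemma pos_of_posDef_spectralSum (hv : Orthonormal ℝ v) {c : Fin p → ℝ}
    (h : (spectralSum c v).PosDef) (i : Fin p) : 0 < c i := by
  have hne : (v i).ofLp ≠ 0 := fun h0 => hv.ne_zero i (by ext j; simp [h0])
  have := h.dotProduct_mulVec_pos hne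
  rwa [star_trivial, dotProduct_spectralSum_mulVec_self hv] at this

open scoped MatrixOrder in
lemma sqrt_spectralSum (hv : Orthonormal ℝ v) {c : Fin p → ℝ} (hc : ∀ i, 0 ≤ c i) :
    CFC.sqrt (spectralSum c v) = spectralSum (fun i => Real.sqrt (c i)) v := by
  refine CFC.sqrt_unique ?_ (Matrix.nonneg_iff_posSemidef.2
    (posSemidef_spectralSum fun i => Real.sqrt_nonneg _))
  rw [spectralSum_mul hv]
  exact congrArg (spectralSum · v) (funext fun i => Real.mul_self_sqrt (hc i))

lemma spectralSum_inv (hv : Orthonormal ℝ v) {c : Fin p → ℝ} (hc : ∀ i, c i ≠ 0) :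
    (spectralSum c v)⁻¹ = spectralSum (fun i => (c i)⁻¹) v := by
  refine Matrix.inv_eq_right_inv ?_
  rw [spectralSum_mul hv, ← spectralSum_one hv]
  exact congrArg (spectralSum · v) (funext fun i => mul_inv_cancel₀ (hc i))

end SpectralSum

/-! ### The log-determinant -/

section LogDet

variable {n : Type*} [Fintype n] [DecidableEq n]

/-- Sum log t ≤ t - 1 over the eigenvalues; it is strict at some eigenvalue, since a symmetric
matrix with all eigenvalues 1 is the identity. -/
lemma card_add_log_det_lt_trace {W : Matrix n n ℝ} (hW : W.PosDef) (hne : W ≠ 1) :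
    Fintype.card n + Real.log W.det < W.trace := by
  have hdet : W.det = ∏ i, hW.1.eigenvalues i := by simpa using hW.1.det_eq_prod_eigenvalues
  have htr : W.trace = ∑ i, hW.1.eigenvalues i := by simpa using hW.1.trace_eq_sum_eigenvalues
  have hex : ∃ i, hW.1.eigenvalues i ≠ 1 := by
    by_contra! hall
    apply hne
    rw [hW.1.spectral_theorem]
    have : (RCLike.ofReal ∘ hW.1.eigenvalues : n → ℝ) = fun _ => 1 := by
      ext i; simp [hall i]
    rw [this, Matrix.diagonal_one, map_one]
  obtain ⟨i, hi⟩ := hex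
  rw [hdet, htr, Real.log_prod fun i _ => (hW.eigenvalues_pos i).ne']
  have := Finset.sum_lt_sum (fun i (_ : i ∈ Finset.univ) =>
    Real.log_le_sub_one_of_pos (hW.eigenvalues_pos i))
    ⟨i, Finset.mem_univ i, Real.log_lt_sub_one_of_pos (hW.eigenvalues_pos i) hi⟩
  simp only [Finset.sum_sub_distrib, Finset.sum_const, Finset.card_univ, nsmul_eq_mul,
    mul_one] at this
  linarith

/-- `X = (A * A)⁻¹` is the unique minimizer of `Y ↦ -log det Y + ⟨A * A, Y⟩`. -/
lemma neg_log_det_add_trace_lt {A X Y : Matrix n n ℝ} (hA : A.PosDef) (hX : A * X * A = 1)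
    (hXdet : X.det ≠ 0) (hY : Y.PosDef) (hne : Y ≠ X) :
    -Real.log X.det + Fintype.card n < -Real.log Y.det + (A * A * Y).trace := by
  have hAu : IsUnit A := hA.isUnit
  have hAT : Aᴴ = A := hA.1
  -- The congruence Y ↦ A Y A moves the candidate minimizer to the identity.
  have hW : (A * Y * A).PosDef := by
    have := hY.conjTranspose_mul_mul_same (B := A) (Matrix.mulVec_injective_of_isUnit hAu)
    rwa [hAT] at this
  have hWne : A * Y * A ≠ 1 := fun h => hne <| by
    rw [← hX] at h
    exact hAu.mul_left_cancel (hAu.mul_right_cancel h)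
  have h := card_add_log_det_lt_trace hW hWne
  have htr : (A * Y * A).trace = (A * A * Y).trace := by
    rw [Matrix.trace_mul_comm, Matrix.mul_assoc]
  have hAd : A.det ≠ 0 := hA.det_pos.ne'
  have h1 : A.det * X.det * A.det = 1 := by
    rw [← Matrix.det_mul, ← Matrix.det_mul, hX, Matrix.det_one]
  have h2 : Real.log A.det + Real.log X.det + Real.log A.det = 0 := by
    rw [← Real.log_mul hAd hXdet, ← Real.log_mul (mul_ne_zero hAd hXdet) hAd, h1, Real.log_one]
  rw [Matrix.det_mul, Matrix.det_mul, Real.log_mul (mul_ne_zero hAd hY.det_pos.ne') hAd,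
    Real.log_mul hAd hY.det_pos.ne', htr] at h
  linarith

/-- Completing the square in the dual objective of the worst-case expectation. -/
lemma dual_objective_eq {A B X : Matrix n n ℝ} {γ : ℝ} (hA : Aᵀ = A) (hB : Bᵀ = B)
    (hD : (γ • (1 : Matrix n n ℝ) - X).PosDef) :
    γ * (((A - B) * (A - B)).trace - (B * B).trace) +
        γ ^ 2 * (((γ • (1 : Matrix n n ℝ) - X)⁻¹)ᵀ * (B * B)).trace =
      (A * A * X).trace +
        (((γ • (1 : Matrix n n ℝ) - X) * A - γ • B)ᵀ * (γ • (1 : Matrix n n ℝ) - X)⁻¹ *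
          ((γ • (1 : Matrix n n ℝ) - X) * A - γ • B)).trace := by
  set D := γ • (1 : Matrix n n ℝ) - X with hDdef
  have hX : X = γ • (1 : Matrix n n ℝ) - D := by rw [hDdef]; abel
  have hDT : Dᵀ = D := hD.1
  have hDi : (D⁻¹)ᵀ = D⁻¹ := hD.inv.1
  have hdet : IsUnit D.det := isUnit_iff_ne_zero.2 hD.det_pos.ne'
  have h1 : D * D⁻¹ = 1 := Matrix.mul_nonsing_inv D hdet
  have h2 : D⁻¹ * D = 1 := Matrix.nonsing_inv_mul D hdet
  have e1 : (D * A - γ • B)ᵀ * D⁻¹ * (D * A - γ • B) =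
      A * D * A - γ • (A * B) - γ • (B * A) + γ ^ 2 • (B * D⁻¹ * B) := by
    rw [Matrix.transpose_sub, Matrix.transpose_mul, Matrix.transpose_smul, hA, hB, hDT,
      Matrix.sub_mul, Matrix.mul_assoc A D, h1, Matrix.mul_one, Matrix.sub_mul, Matrix.mul_sub,
      Matrix.mul_sub, ← Matrix.mul_assoc A D A, Matrix.mul_smul, Matrix.mul_smul, Matrix.smul_mul,
      Matrix.smul_mul, Matrix.smul_mul, Matrix.mul_assoc B D⁻¹ (D * A), ← Matrix.mul_assoc D⁻¹ D A,
      h2, Matrix.one_mul, smul_smul, sq]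
    abel
  have e2 : (A * D * A).trace = (A * A * D).trace := by
    rw [Matrix.trace_mul_comm, Matrix.mul_assoc]
  have e3 : (B * D⁻¹ * B).trace = (D⁻¹ * (B * B)).trace := by
    rw [Matrix.mul_assoc, Matrix.trace_mul_comm, Matrix.mul_assoc]
  have e4 : (B * A).trace = (A * B).trace := Matrix.trace_mul_comm _ _
  rw [e1, hX, hDi]
  simp only [Matrix.mul_sub, Matrix.sub_mul, Matrix.mul_smul, Matrix.mul_one, Matrix.trace_sub,
    Matrix.trace_add, Matrix.trace_smul, smul_eq_mul, e2, e3, e4]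
  ring

end LogDet

/-! ### The dual equation -/

section Scalar

/-- The ratio `√l / √s` of an eigenvalue `l` of the nominal covariance matrix and the
corresponding eigenvalue `s` of the extremal covariance matrix. -/
def sqrtRatio (γ l : ℝ) : ℝ := 1 / 2 * (Real.sqrt (l ^ 2 * γ ^ 2 + 4 * l * γ) - l * γ)

variable {γ l : ℝ}

lemma sqrtRatio_nonneg (hγ : 0 ≤ γ) (hl : 0 ≤ l) : 0 ≤ sqrtRatio γ l := by
  have : l * γ ≤ Real.sqrt (l ^ 2 * γ ^ 2 + 4 * l * γ) :=
    Real.le_sqrt_of_sq_le (by nlinarith [mul_nonneg hl hγ])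
  unfold sqrtRatio
  linarith

lemma sqrtRatio_lt_one (hγ : 0 ≤ γ) (hl : 0 ≤ l) : sqrtRatio γ l < 1 := by
  have : Real.sqrt (l ^ 2 * γ ^ 2 + 4 * l * γ) < l * γ + 2 :=
    (Real.sqrt_lt' (by positivity)).2 (by nlinarith [mul_nonneg hl hγ])
  unfold sqrtRatio
  linarith

/-- The quadratic equation behind the radical; the later eigenvalue identities are consequences of
it. -/
lemma sqrtRatio_sq (hγ : 0 ≤ γ) (hl : 0 ≤ l) :
    sqrtRatio γ l ^ 2 = l * γ * (1 - sqrtRatio γ l) := by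
  have := Real.sq_sqrt (show 0 ≤ l ^ 2 * γ ^ 2 + 4 * l * γ by positivity)
  unfold sqrtRatio
  nlinarith

lemma sqrtRatio_zero_right : sqrtRatio γ 0 = 0 := by simp [sqrtRatio]

lemma sqrtRatio_zero_left : sqrtRatio 0 l = 0 := by simp [sqrtRatio]

lemma sqrtRatio_pos (hγ : 0 < γ) (hl : 0 < l) : 0 < sqrtRatio γ l := by
  refine lt_of_le_of_ne (sqrtRatio_nonneg hγ.le hl.le) fun h => ?_
  have := sqrtRatio_sq hγ.le hl.le
  rw [← h] at this
  nlinarith [mul_pos hl hγ]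

/-- If u dropped as γ grew, u² would fall while lγ(1 - u) would not. -/
lemma sqrtRatio_mono (hl : 0 ≤ l) {γ' : ℝ} (hγ : 0 ≤ γ) (h : γ ≤ γ') :
    sqrtRatio γ l ≤ sqrtRatio γ' l := by
  by_contra! hlt
  have h1 := sqrtRatio_sq hγ hl
  have h2 := sqrtRatio_sq (hγ.trans h) hl
  have h3 := sqrtRatio_nonneg (hγ.trans h) hl
  have h4 := sqrtRatio_lt_one hγ hl
  have h5 : l * γ * (1 - sqrtRatio γ l) ≤ l * γ' * (1 - sqrtRatio γ' l) := by
    have := mul_le_mul_of_nonneg_left h hl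
    exact mul_le_mul this (by linarith) (by linarith) (mul_nonneg hl (hγ.trans h))
  nlinarith

lemma continuous_sqrtRatio (l : ℝ) : Continuous fun γ => sqrtRatio γ l := by
  unfold sqrtRatio
  fun_prop

lemma estimatorEigenvalue_eq (γ l : ℝ) :
    estimatorEigenvalue γ l = γ * (1 - sqrtRatio γ l) := rfl

lemma estimatorEigenvalue_pos (hγ : 0 < γ) (hl : 0 ≤ l) : 0 < estimatorEigenvalue γ l :=
  mul_pos hγ (sub_pos.2 (sqrtRatio_lt_one hγ.le hl))

/-- Since γ - x = γu, the quotient is l/u² for l > 0, which the quadratic equation turns into 1/x.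
At l = 0 it would be 0/0, and x = γ there explains the separate value γ⁻¹. -/
lemma extremalEigenvalue_eq_inv (hγ : 0 < γ) (hl : 0 ≤ l) :
    extremalEigenvalue γ l = (estimatorEigenvalue γ l)⁻¹ := by
  rcases hl.eq_or_lt with rfl | hl'
  · simp [extremalEigenvalue, estimatorEigenvalue_eq, sqrtRatio_zero_right]
  · have hu := sqrtRatio_pos hγ hl'
    have h1 := sqrtRatio_lt_one hγ.le hl
    have hx := estimatorEigenvalue_pos hγ hl
    rw [extremalEigenvalue, if_pos hl', eq_comm, inv_eq_one_div, div_eq_div_iff hx.ne',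
      estimatorEigenvalue_eq]
    · linear_combination γ ^ 2 * sqrtRatio_sq hγ.le hl
    · rw [estimatorEigenvalue_eq]
      have : γ - γ * (1 - sqrtRatio γ l) = γ * sqrtRatio γ l := by ring
      rw [this]
      positivity

lemma extremalEigenvalue_pos (hγ : 0 < γ) (hl : 0 ≤ l) : 0 < extremalEigenvalue γ l := by
  rw [extremalEigenvalue_eq_inv hγ hl]
  exact inv_pos.2 (estimatorEigenvalue_pos hγ hl)

/-- This is the stationarity condition (γ - x)√s = γ√l, divided by γ. -/
lemma sqrt_eq_sqrtRatio_mul (hγ : 0 < γ) (hl : 0 ≤ l) :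
    Real.sqrt l = sqrtRatio γ l * Real.sqrt (extremalEigenvalue γ l) := by
  have hs := extremalEigenvalue_pos hγ hl
  have hx := estimatorEigenvalue_pos hγ hl
  refine (Real.sqrt_eq_iff_mul_self_eq hl
    (mul_nonneg (sqrtRatio_nonneg hγ.le hl) (Real.sqrt_nonneg _))).2 ?_
  rw [mul_mul_mul_comm, Real.mul_self_sqrt hs.le, extremalEigenvalue_eq_inv hγ hl,
    ← div_eq_mul_inv, eq_comm, div_eq_iff hx.ne', estimatorEigenvalue_eq]
  linear_combination sqrtRatio_sq hγ.le hl

lemma sq_sqrt_sub_sqrt (hγ : 0 < γ) (hl : 0 ≤ l) :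
    (Real.sqrt (extremalEigenvalue γ l) - Real.sqrt l) * (Real.sqrt (extremalEigenvalue γ l) -
      Real.sqrt l) = (1 - sqrtRatio γ l) / γ := by
  have hs := extremalEigenvalue_pos hγ hl
  have h1 := sqrtRatio_lt_one hγ.le hl
  have e : extremalEigenvalue γ l * (γ * (1 - sqrtRatio γ l)) = 1 := by
    rw [extremalEigenvalue_eq_inv hγ hl, ← estimatorEigenvalue_eq]
    exact inv_mul_cancel₀ (estimatorEigenvalue_pos hγ hl).ne'
  rw [sqrt_eq_sqrtRatio_mul hγ hl, eq_div_iff hγ.ne']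
  have h2 := Real.mul_self_sqrt hs.le
  linear_combination (1 - sqrtRatio γ l) ^ 2 * γ * h2 + (1 - sqrtRatio γ l) * e

variable {p : ℕ} {ρ : ℝ} {lam : Fin p → ℝ}

lemma solvesDualEquation_iff :
    SolvesDualEquation ρ lam γ ↔ 0 < γ ∧ ρ ^ 2 * γ - p + ∑ i, sqrtRatio γ (lam i) = 0 := by
  have : ∑ i, sqrtRatio γ (lam i) =
      1 / 2 * ∑ i, Real.sqrt (lam i ^ 2 * γ ^ 2 + 4 * lam i * γ) - 1 / 2 * (∑ i, lam i) * γ := by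
    simp only [sqrtRatio, Finset.mul_sum, Finset.sum_mul, ← Finset.sum_sub_distrib]
    exact Finset.sum_congr rfl fun i _ => by ring
  unfold SolvesDualEquation
  refine and_congr_right fun _ => ?_
  rw [this]
  constructor <;> intro h <;> linarith

lemma existsUnique_solvesDualEquation (hp : 0 < p) (hρ : 0 < ρ) (hlam : ∀ i, 0 ≤ lam i) :
    ∃! γ : ℝ, SolvesDualEquation ρ lam γ := by
  have hp' : (0 : ℝ) < p := by exact_mod_cast hp
  simp only [solvesDualEquation_iff]
  refine existsUnique_of_exists_of_unique ?_ ?_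
  -- The function is -p at 0; at p/ρ² the first two terms cancel and a nonnegative sum remains.
  · have hc : ContinuousOn (fun γ => ρ ^ 2 * γ - p + ∑ i, sqrtRatio γ (lam i))
        (Set.Icc 0 (p / ρ ^ 2)) := by
      have := fun i => continuous_sqrtRatio (lam i)
      fun_prop
    have hb : 0 ≤ (p : ℝ) / ρ ^ 2 := by positivity
    obtain ⟨γ, ⟨h0, -⟩, hγ⟩ := intermediate_value_Icc hb hc (show (0 : ℝ) ∈ Set.Icc _ _ from by
      constructor
      · simp [sqrtRatio_zero_left]
      · have h1 : ρ ^ 2 * (p / ρ ^ 2) = p := by field_simp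
        rw [h1, sub_self, zero_add]
        exact Finset.sum_nonneg fun i _ => sqrtRatio_nonneg hb (hlam i))
    refine ⟨γ, lt_of_le_of_ne h0 ?_, hγ⟩
    rintro rfl
    simp [sqrtRatio_zero_left, hp.ne'] at hγ
  · have key : ∀ a b : ℝ, 0 < a → a < b → ρ ^ 2 * a - p + ∑ i, sqrtRatio a (lam i) <
        ρ ^ 2 * b - p + ∑ i, sqrtRatio b (lam i) := fun a b ha hab => by
      have h1 := Finset.sum_le_sum fun i (_ : i ∈ Finset.univ) =>
        sqrtRatio_mono (hlam i) ha.le hab.le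
      have h2 := mul_lt_mul_of_pos_left hab (pow_pos hρ 2)
      linarith
    rintro a b ⟨ha, hfa⟩ ⟨hb, hfb⟩
    rcases lt_trichotomy a b with h | h | h
    · linarith [key a b ha h]
    · exact h
    · linarith [key b a hb h]

end Scalar

/-! ### Second moments of Gaussian distributions and couplings -/

section Gaussian

variable {p : ℕ}

lemma integrable_inner_sq_multivariateGaussian (S : Matrix (Fin p) (Fin p) ℝ)
    (w : EuclideanSpace ℝ (Fin p)) :
    Integrable (fun x => inner ℝ w x ^ 2) (multivariateGaussian 0 S) :=
  ((innerSL ℝ w).comp_memLp' (IsGaussian.memLp_two_id (μ := multivariateGaussian 0 S))).integrable_sq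

lemma memLp_two_eval_multivariateGaussian (S : Matrix (Fin p) (Fin p) ℝ) (i : Fin p) :
    MemLp (fun x : EuclideanSpace ℝ (Fin p) => x i) 2 (multivariateGaussian 0 S) :=
  (EuclideanSpace.proj i : EuclideanSpace ℝ (Fin p) →L[ℝ] ℝ).comp_memLp'
    (IsGaussian.memLp_two_id (μ := multivariateGaussian 0 S))

lemma integrable_mul_multivariateGaussian (S : Matrix (Fin p) (Fin p) ℝ) (i j : Fin p) :
    Integrable (fun x => x i * x j) (multivariateGaussian 0 S) :=
  (memLp_two_eval_multivariateGaussian S i).integrable_mul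
    (memLp_two_eval_multivariateGaussian S j)

lemma integral_mul_multivariateGaussian {S : Matrix (Fin p) (Fin p) ℝ} (hS : S.PosSemidef)
    (i j : Fin p) : ∫ x, x i * x j ∂(multivariateGaussian 0 S) = S i j := by
  have hL := memLp_two_eval_multivariateGaussian S
  have hm (i : Fin p) : ∫ x, x i ∂(multivariateGaussian 0 S) = 0 := by
    have := (EuclideanSpace.proj i : EuclideanSpace ℝ (Fin p) →L[ℝ] ℝ).integral_comp_id_comm
      (IsGaussian.integrable_id (μ := multivariateGaussian 0 S))
    simpa using this
  have h := covariance_eval_multivariateGaussian (μ := 0) hS i j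
  rw [covariance_eq_sub (hL i) (hL j), hm i, zero_mul, sub_zero] at h
  exact h

lemma quadratic_eq_sum (X : Matrix (Fin p) (Fin p) ℝ) (x : EuclideanSpace ℝ (Fin p)) :
    x.ofLp ⬝ᵥ (X *ᵥ x.ofLp) = ∑ i, ∑ j, X i j * (x i * x j) := by
  simp only [dotProduct, Matrix.mulVec, Finset.mul_sum]
  exact Finset.sum_congr rfl fun i _ => Finset.sum_congr rfl fun j _ => by ring

lemma expectedQuadratic_multivariateGaussian {S : Matrix (Fin p) (Fin p) ℝ} (hS : S.PosSemidef)
    (X : Matrix (Fin p) (Fin p) ℝ) :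
    expectedQuadratic (multivariateGaussian 0 S) X = (S * X).trace := by
  have hi := fun i j => (integrable_mul_multivariateGaussian S i j).const_mul (X i j)
  simp only [expectedQuadratic, quadratic_eq_sum]
  rw [integral_finsetSum _ fun i _ => integrable_finsetSum _ fun j _ => hi i j]
  simp only [Matrix.trace, Matrix.diag, Matrix.mul_apply]
  rw [Finset.sum_congr rfl fun i _ => integral_finsetSum _ fun j _ => hi i j]
  simp only [integral_const_mul, integral_mul_multivariateGaussian hS]
  rw [Finset.sum_comm]
  have hST (i j : Fin p) : S i j = S j i := by simpa using hS.1.apply j i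
  exact Finset.sum_congr rfl fun i _ => Finset.sum_congr rfl fun j _ => by
    rw [mul_comm, hST j i]

open scoped MatrixOrder in
/-- The coupling of two Gaussian distributions that are driven by the same standard normal
random vector bounds their Wasserstein distance. -/
lemma wasserstein_multivariateGaussian_le {S T : Matrix (Fin p) (Fin p) ℝ} :
    wasserstein (multivariateGaussian 0 S) (multivariateGaussian 0 T) ≤
      ENNReal.ofReal (((CFC.sqrt S - CFC.sqrt T)ᵀ * (CFC.sqrt S - CFC.sqrt T)).trace) ^
        (1 / 2 : ℝ) := by
  set A := Matrix.toEuclideanCLM (𝕜 := ℝ) (CFC.sqrt S)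
  set B := Matrix.toEuclideanCLM (𝕜 := ℝ) (CFC.sqrt T)
  set C := CFC.sqrt S - CFC.sqrt T with hC
  set P := stdGaussian (EuclideanSpace ℝ (Fin p))
  have hmeas : Measurable fun x => (A x, B x) := by fun_prop
  have hmem : P.map (fun x => (A x, B x)) ∈
      couplings (multivariateGaussian 0 S) (multivariateGaussian 0 T) := by
    constructor
    · rw [Measure.map_map measurable_fst hmeas]
      simp [multivariateGaussian, Function.comp_def, A, P]
    · rw [Measure.map_map measurable_snd hmeas]
      simp [multivariateGaussian, Function.comp_def, B, P]
  refine (iInf₂_le _ hmem).trans (ENNReal.rpow_le_rpow ?_ (by norm_num))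
  rw [lintegral_map (by fun_prop) hmeas]
  have hnorm (x : EuclideanSpace ℝ (Fin p)) :
      ‖A x - B x‖ ^ 2 = x.ofLp ⬝ᵥ ((Cᵀ * C) *ᵥ x.ofLp) := by
    have : A x - B x = Matrix.toEuclideanCLM (𝕜 := ℝ) C x := by simp [A, B, hC]
    rw [this, EuclideanSpace.real_norm_sq_eq, ← Matrix.mulVec_mulVec, Matrix.dotProduct_mulVec,
      Matrix.vecMul_transpose]
    simp [dotProduct, sq]
  have henorm (x : EuclideanSpace ℝ (Fin p)) :
      ‖A x - B x‖ₑ ^ 2 = ENNReal.ofReal (x.ofLp ⬝ᵥ ((Cᵀ * C) *ᵥ x.ofLp)) := by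
    rw [← hnorm, ← ofReal_norm, ENNReal.ofReal_pow (norm_nonneg _)]
  have hP : P = multivariateGaussian 0 (1 : Matrix (Fin p) (Fin p) ℝ) :=
    multivariateGaussian_zero_one.symm
  simp only [henorm]
  rw [← ofReal_integral_eq_lintegral_ofReal]
  · have := expectedQuadratic_multivariateGaussian (Matrix.PosSemidef.one (n := Fin p) (R := ℝ))
      (Cᵀ * C)
    rw [expectedQuadratic, ← hP, Matrix.one_mul] at this
    rw [this]
  · simp only [quadratic_eq_sum, hP]
    exact integrable_finsetSum _ fun i _ => integrable_finsetSum _ fun j _ =>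
      (integrable_mul_multivariateGaussian 1 i j).const_mul _
  · exact .of_forall fun x => by simp only [← hnorm]; positivity

end Gaussian

/-! ### Weak duality for the worst-case expectation at the estimator -/

section WorstCase

variable {p : ℕ} {v : Fin p → EuclideanSpace ℝ (Fin p)} {lam : Fin p → ℝ} {γ ρ : ℝ}

lemma integral_inner_sq_spectralSum (hv : Orthonormal ℝ v) (hlam : ∀ i, 0 ≤ lam i) (i : Fin p) :
    ∫ x, inner ℝ (v i) x ^ 2 ∂(multivariateGaussian 0 (spectralSum lam v)) = lam i := by
  have h := expectedQuadratic_multivariateGaussian (posSemidef_spectralSum (v := v) hlam)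
    -- The indicator selects the rank-one form v_i v_iᵀ.
    (spectralSum (fun j => if j = i then 1 else 0) v)
  rw [spectralSum_mul hv, trace_spectralSum hv] at h
  simpa [expectedQuadratic, dotProduct_spectralSum_mulVec] using h

/-- The one-dimensional conjugacy inequality behind weak duality. -/
lemma estimatorEigenvalue_mul_sq_le (hγ : 0 < γ) {l : ℝ} (hl : 0 ≤ l) (a b : ℝ)
    (hb : l = 0 → b ^ 2 = 0) :
    estimatorEigenvalue γ l * a ^ 2 ≤
      γ * (a - b) ^ 2 + γ * (1 - sqrtRatio γ l) / sqrtRatio γ l * b ^ 2 := by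
  rw [estimatorEigenvalue_eq]
  rcases hl.eq_or_lt with rfl | hl'
  -- Here u = 0, and division by zero makes the coefficient of b² equal to 0, so the bound relies on
  -- b = 0.
  · have : b = 0 := by simpa using hb rfl
    simp [this, sqrtRatio_zero_right]
  · have hu := sqrtRatio_pos hγ hl'
    set u := sqrtRatio γ l
    have : γ * (a - b) ^ 2 + γ * (1 - u) / u * b ^ 2 - γ * (1 - u) * a ^ 2 =
        γ / u * (u * a - b) ^ 2 := by
      field_simp
      ring
    have h2 : 0 ≤ γ / u * (u * a - b) ^ 2 := by positivity
    linarith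

/-- Since b² has mean l under the nominal law, the b² term of the conjugacy inequality contributes
exactly u. -/
lemma conjugate_coefficient_mul (hγ : 0 < γ) {l : ℝ} (hl : 0 ≤ l) :
    γ * (1 - sqrtRatio γ l) / sqrtRatio γ l * l = sqrtRatio γ l := by
  rcases hl.eq_or_lt with rfl | hl'
  · simp [sqrtRatio_zero_right]
  · have hu := sqrtRatio_pos hγ hl'
    rw [div_mul_eq_mul_div, div_eq_iff hu.ne']
    linear_combination -sqrtRatio_sq hγ.le hl

/-- Weak duality along a single coupling. -/
lemma expectedQuadratic_estimator_le_of_coupling (hv : Orthonormal ℝ v) (hlam : ∀ i, 0 ≤ lam i)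
    (hγ : 0 < γ) (S : Matrix (Fin p) (Fin p) ℝ)
    {π : Measure (EuclideanSpace ℝ (Fin p) × EuclideanSpace ℝ (Fin p))}
    (hπ : π ∈ couplings (multivariateGaussian 0 S) (multivariateGaussian 0 (spectralSum lam v)))
    {r : ℝ} (hr : 0 ≤ r) (hcost : ∫⁻ z, ‖z.1 - z.2‖ₑ ^ 2 ∂π ≤ ENNReal.ofReal r) :
    expectedQuadratic (multivariateGaussian 0 S) (estimator γ lam v) ≤
      γ * r + ∑ i, sqrtRatio γ (lam i) := by
  obtain ⟨h1, h2⟩ := hπ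
  set Q := multivariateGaussian 0 S
  set P := multivariateGaussian 0 (spectralSum lam v)
  have i1 (i : Fin p) : Integrable (fun z => inner ℝ (v i) z.1 ^ 2) π := by
    have := integrable_inner_sq_multivariateGaussian S (v i)
    change Integrable _ Q at this
    rw [← h1] at this
    exact this.comp_measurable measurable_fst
  have i2 (i : Fin p) : Integrable (fun z => inner ℝ (v i) z.2 ^ 2) π := by
    have := integrable_inner_sq_multivariateGaussian (spectralSum lam v) (v i)
    change Integrable _ P at this
    rw [← h2] at this
    exact this.comp_measurable measurable_snd
  have e1 (i : Fin p) : ∫ x, inner ℝ (v i) x ^ 2 ∂Q = ∫ z, inner ℝ (v i) z.1 ^ 2 ∂π := by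
    rw [← h1, integral_map measurable_fst.aemeasurable
      (Continuous.aestronglyMeasurable (by fun_prop))]
  have e2 (i : Fin p) : ∫ z, inner ℝ (v i) z.2 ^ 2 ∂π = lam i := by
    rw [← integral_inner_sq_spectralSum hv hlam i]
    change _ = ∫ x, _ ∂P
    rw [← h2, integral_map measurable_snd.aemeasurable
      (Continuous.aestronglyMeasurable (by fun_prop))]
  have hcost' : ∫⁻ z, ENNReal.ofReal (‖z.1 - z.2‖ ^ 2) ∂π ≤ ENNReal.ofReal r := by
    refine le_trans (le_of_eq (lintegral_congr fun z => ?_)) hcost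
    rw [← ofReal_norm, ENNReal.ofReal_pow (norm_nonneg _)]
  have hsm : AEStronglyMeasurable (fun z : EuclideanSpace ℝ (Fin p) × EuclideanSpace ℝ (Fin p) =>
      ‖z.1 - z.2‖ ^ 2) π := Continuous.aestronglyMeasurable (by fun_prop)
  have h0 : 0 ≤ᵐ[π] fun z => ‖z.1 - z.2‖ ^ 2 := .of_forall fun z => by positivity
  have i3 : Integrable (fun z => ‖z.1 - z.2‖ ^ 2) π :=
    (lintegral_ofReal_ne_top_iff_integrable hsm h0).1
      (hcost'.trans_lt ENNReal.ofReal_lt_top).ne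
  have e3 : ∫ z, ‖z.1 - z.2‖ ^ 2 ∂π ≤ r := by
    rw [integral_eq_lintegral_of_nonneg_ae h0 hsm]
    exact ENNReal.toReal_le_of_le_ofReal hr hcost'
  -- The nominal Gaussian is degenerate along null eigenvectors; this covers singular covariances
  -- without a limiting argument.
  have hae : ∀ᵐ z ∂π, ∀ i, lam i = 0 → inner ℝ (v i) z.2 ^ 2 = 0 := by
    rw [ae_all_iff]
    intro i
    by_cases hi : lam i = 0
    · have := (integral_eq_zero_iff_of_nonneg (fun z => sq_nonneg _) (i2 i)).1 ((e2 i).trans hi)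
      filter_upwards [this] with z hz _ using hz
    · exact .of_forall fun z h => absurd h hi
  set k : Fin p → ℝ := fun i =>
    γ * (1 - sqrtRatio γ (lam i)) / sqrtRatio γ (lam i) with hk
  calc expectedQuadratic Q (estimator γ lam v)
      = ∫ x, ∑ i, estimatorEigenvalue γ (lam i) * inner ℝ (v i) x ^ 2 ∂Q := by
        simp only [expectedQuadratic, estimator, dotProduct_spectralSum_mulVec]
    _ = ∑ i, estimatorEigenvalue γ (lam i) * ∫ x, inner ℝ (v i) x ^ 2 ∂Q := by
        rw [integral_finsetSum _ fun i _ =>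
          (integrable_inner_sq_multivariateGaussian S (v i)).const_mul _]
        simp only [integral_const_mul, Q]
    _ = ∫ z, ∑ i, estimatorEigenvalue γ (lam i) * inner ℝ (v i) z.1 ^ 2 ∂π := by
        rw [integral_finsetSum _ fun i _ => (i1 i).const_mul _]
        simp only [integral_const_mul, e1]
    _ ≤ ∫ z, γ * ‖z.1 - z.2‖ ^ 2 + ∑ i, k i * inner ℝ (v i) z.2 ^ 2 ∂π := by
        refine integral_mono_ae (integrable_finsetSum _ fun i _ => (i1 i).const_mul _)
          ((i3.const_mul _).add (integrable_finsetSum _ fun i _ => (i2 i).const_mul _)) ?_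
        filter_upwards [hae] with z hz
        rw [← sum_inner_sq_eq_norm_sq hv, Finset.mul_sum, ← Finset.sum_add_distrib]
        refine Finset.sum_le_sum fun i _ => ?_
        rw [inner_sub_right]
        exact estimatorEigenvalue_mul_sq_le hγ (hlam i) _ _ (hz i)
    _ = γ * ∫ z, ‖z.1 - z.2‖ ^ 2 ∂π + ∑ i, k i * lam i := by
        rw [integral_add (i3.const_mul _) (integrable_finsetSum _ fun i _ => (i2 i).const_mul _),
          integral_const_mul, integral_finsetSum _ fun i _ => (i2 i).const_mul _]
        simp only [integral_const_mul, e2]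
    _ ≤ _ := by
        refine add_le_add (mul_le_mul_of_nonneg_left e3 hγ.le) (Finset.sum_le_sum fun i _ => ?_)
        exact (conjugate_coefficient_mul hγ (hlam i)).le

lemma expectedQuadratic_estimator_le (hρ : 0 < ρ) (hv : Orthonormal ℝ v)
    (hlam : ∀ i, 0 ≤ lam i) (hγ : SolvesDualEquation ρ lam γ)
    {Q : Measure (EuclideanSpace ℝ (Fin p))} (hQ : Q ∈ ambiguitySet ρ (spectralSum lam v)) :
    expectedQuadratic Q (estimator γ lam v) ≤ p := by
  obtain ⟨hγ0, hγe⟩ := solvesDualEquation_iff.1 hγ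
  obtain ⟨⟨S, -, rfl⟩, hW⟩ := hQ
  -- Existence of an optimal coupling is avoided: for each t > ρ some coupling costs less than t,
  -- and then t decreases to ρ.
  have key : ∀ t, ρ < t → expectedQuadratic (multivariateGaussian 0 S) (estimator γ lam v) ≤
      γ * t ^ 2 + ∑ i, sqrtRatio γ (lam i) := fun t ht => by
    have ht0 : 0 < t := hρ.trans ht
    have hlt := hW.trans_lt ((ENNReal.ofReal_lt_ofReal_iff ht0).2 ht)
    simp only [wasserstein, iInf_lt_iff] at hlt
    obtain ⟨π, hπ, hlt⟩ := hlt
    refine expectedQuadratic_estimator_le_of_coupling hv hlam hγ0 S hπ (sq_nonneg t) ?_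
    have := ENNReal.rpow_le_rpow hlt.le (show (0 : ℝ) ≤ 2 by norm_num)
    rw [← ENNReal.rpow_mul] at this
    norm_num at this
    rwa [ENNReal.ofReal_pow ht0.le]
  have hlim : Filter.Tendsto (fun t : ℝ => γ * t ^ 2 + ∑ i, sqrtRatio γ (lam i))
      (nhdsWithin ρ (Set.Ioi ρ)) (nhds (γ * ρ ^ 2 + ∑ i, sqrtRatio γ (lam i))) :=
    (Continuous.tendsto (by fun_prop) ρ).mono_left nhdsWithin_le_nhds
  have := ge_of_tendsto hlim (Filter.eventually_of_mem self_mem_nhdsWithin key)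
  linarith

end WorstCase

/-! ### The saddle point -/

section SaddlePoint

variable {p : ℕ} {v : Fin p → EuclideanSpace ℝ (Fin p)} {lam : Fin p → ℝ} {γ ρ : ℝ}

lemma posDef_estimator (hv : Orthonormal ℝ v) (hlam : ∀ i, 0 ≤ lam i) (hγ : 0 < γ) :
    (estimator γ lam v).PosDef :=
  posDef_spectralSum hv fun i => estimatorEigenvalue_pos hγ (hlam i)

lemma posSemidef_extremalCovariance (hlam : ∀ i, 0 ≤ lam i) (hγ : 0 < γ) :
    (extremalCovariance γ lam v).PosSemidef :=
  posSemidef_spectralSum fun i => (extremalEigenvalue_pos hγ (hlam i)).le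

/-- The positive definite square root of the extremal covariance matrix. -/
def extremalRoot (γ : ℝ) (lam : Fin p → ℝ) (v : Fin p → EuclideanSpace ℝ (Fin p)) :
    Matrix (Fin p) (Fin p) ℝ :=
  spectralSum (fun i => Real.sqrt (extremalEigenvalue γ (lam i))) v

lemma posDef_extremalRoot (hv : Orthonormal ℝ v) (hlam : ∀ i, 0 ≤ lam i) (hγ : 0 < γ) :
    (extremalRoot γ lam v).PosDef :=
  posDef_spectralSum hv fun i => Real.sqrt_pos.2 (extremalEigenvalue_pos hγ (hlam i))

lemma extremalRoot_mul_self (hv : Orthonormal ℝ v) (hlam : ∀ i, 0 ≤ lam i) (hγ : 0 < γ) :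
    extremalRoot γ lam v * extremalRoot γ lam v = extremalCovariance γ lam v := by
  rw [extremalRoot, spectralSum_mul hv]
  exact congrArg (spectralSum · v)
    (funext fun i => Real.mul_self_sqrt (extremalEigenvalue_pos hγ (hlam i)).le)

lemma extremalCovariance_mul_estimator (hv : Orthonormal ℝ v) (hlam : ∀ i, 0 ≤ lam i)
    (hγ : 0 < γ) : extremalCovariance γ lam v * estimator γ lam v = 1 := by
  rw [extremalCovariance, estimator, spectralSum_mul hv, ← spectralSum_one hv]
  refine congrArg (spectralSum · v) (funext fun i => ?_)
  rw [extremalEigenvalue_eq_inv hγ (hlam i)]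
  exact inv_mul_cancel₀ (estimatorEigenvalue_pos hγ (hlam i)).ne'

lemma extremalRoot_mul_estimator_mul_extremalRoot (hv : Orthonormal ℝ v)
    (hlam : ∀ i, 0 ≤ lam i) (hγ : 0 < γ) :
    extremalRoot γ lam v * estimator γ lam v * extremalRoot γ lam v = 1 := by
  have h := extremalCovariance_mul_estimator hv hlam hγ
  rw [← extremalRoot_mul_self hv hlam hγ, Matrix.mul_assoc] at h
  exact mul_eq_one_comm.1 h

lemma neg_log_det_estimator_add_lt (hv : Orthonormal ℝ v) (hlam : ∀ i, 0 ≤ lam i) (hγ : 0 < γ)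
    {Y : Matrix (Fin p) (Fin p) ℝ} (hY : Y.PosDef) (hne : Y ≠ estimator γ lam v) :
    -Real.log (estimator γ lam v).det + p <
      -Real.log Y.det + (extremalCovariance γ lam v * Y).trace := by
  have := neg_log_det_add_trace_lt (posDef_extremalRoot hv hlam hγ)
    (extremalRoot_mul_estimator_mul_extremalRoot hv hlam hγ)
    (posDef_estimator hv hlam hγ).det_pos.ne' hY hne
  rwa [extremalRoot_mul_self hv hlam hγ, Fintype.card_fin] at this

lemma trace_sq_sub_extremalRoot (hv : Orthonormal ℝ v) (hlam : ∀ i, 0 ≤ lam i)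
    (hγ : SolvesDualEquation ρ lam γ) :
    ((extremalRoot γ lam v - spectralSum (fun i => Real.sqrt (lam i)) v) *
      (extremalRoot γ lam v - spectralSum (fun i => Real.sqrt (lam i)) v)).trace = ρ ^ 2 := by
  obtain ⟨hγ0, hγe⟩ := solvesDualEquation_iff.1 hγ
  rw [extremalRoot, spectralSum_sub, spectralSum_mul hv, trace_spectralSum hv,
    Finset.sum_congr rfl fun i _ => sq_sqrt_sub_sqrt hγ0 (hlam i), ← Finset.sum_div,
    div_eq_iff hγ0.ne', Finset.sum_sub_distrib]
  simp only [Finset.sum_const, Finset.card_univ, Fintype.card_fin, nsmul_eq_mul, mul_one]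
  linarith

open scoped MatrixOrder in
lemma extremal_mem_ambiguitySet (hρ : 0 < ρ) (hv : Orthonormal ℝ v) (hlam : ∀ i, 0 ≤ lam i)
    (hγ : SolvesDualEquation ρ lam γ) :
    multivariateGaussian 0 (extremalCovariance γ lam v) ∈
      ambiguitySet ρ (spectralSum lam v) := by
  refine ⟨⟨_, posSemidef_extremalCovariance hlam hγ.1, rfl⟩,
    wasserstein_multivariateGaussian_le.trans ?_⟩
  have hs : CFC.sqrt (extremalCovariance γ lam v) = extremalRoot γ lam v :=
    sqrt_spectralSum hv fun i => (extremalEigenvalue_pos hγ.1 (hlam i)).le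
  rw [hs, sqrt_spectralSum hv hlam, Matrix.transpose_sub, extremalRoot, spectralSum_transpose,
    spectralSum_transpose, ← extremalRoot, trace_sq_sub_extremalRoot hv hlam hγ,
    ENNReal.ofReal_rpow_of_nonneg (sq_nonneg ρ) (by norm_num), ← Real.sqrt_eq_rpow,
    Real.sqrt_sq hρ.le]

lemma expectedQuadratic_extremal_estimator (hv : Orthonormal ℝ v) (hlam : ∀ i, 0 ≤ lam i)
    (hγ : 0 < γ) :
    expectedQuadratic (multivariateGaussian 0 (extremalCovariance γ lam v))
      (estimator γ lam v) = p := by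
  rw [expectedQuadratic_multivariateGaussian (posSemidef_extremalCovariance hlam hγ),
    extremalCovariance_mul_estimator hv hlam hγ, Matrix.trace_one, Fintype.card_fin]

lemma worstCase_estimator (hρ : 0 < ρ) (hv : Orthonormal ℝ v) (hlam : ∀ i, 0 ≤ lam i)
    (hγ : SolvesDualEquation ρ lam γ) :
    worstCase ρ (spectralSum lam v) (estimator γ lam v) = ((p : ℝ) : EReal) := by
  refine le_antisymm (iSup₂_le fun Q hQ =>
    EReal.coe_le_coe_iff.2 (expectedQuadratic_estimator_le hρ hv hlam hγ hQ)) ?_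
  rw [← expectedQuadratic_extremal_estimator hv hlam hγ.1]
  exact le_iSup₂ (f := fun Q (_ : Q ∈ ambiguitySet ρ (spectralSum lam v)) =>
    (expectedQuadratic Q (estimator γ lam v) : EReal)) _
    (extremal_mem_ambiguitySet hρ hv hlam hγ)

lemma attainsWorstCase_extremal (hρ : 0 < ρ) (hv : Orthonormal ℝ v) (hlam : ∀ i, 0 ≤ lam i)
    (hγ : SolvesDualEquation ρ lam γ) :
    AttainsWorstCase ρ (spectralSum lam v) (estimator γ lam v)
      (multivariateGaussian 0 (extremalCovariance γ lam v)) :=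
  ⟨extremal_mem_ambiguitySet hρ hv hlam hγ, by
    rw [worstCase_estimator hρ hv hlam hγ, expectedQuadratic_extremal_estimator hv hlam hγ.1]⟩

lemma isUniqueRobustMinimizer_estimator (hρ : 0 < ρ) (hv : Orthonormal ℝ v)
    (hlam : ∀ i, 0 ≤ lam i) (hγ : SolvesDualEquation ρ lam γ) :
    IsUniqueRobustMinimizer ρ (spectralSum lam v) (estimator γ lam v) := by
  refine ⟨posDef_estimator hv hlam hγ.1, fun Y hY hne => ?_⟩
  have hlt := neg_log_det_estimator_add_lt hv hlam hγ.1 hY hne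
  rw [robustObjective, worstCase_estimator hρ hv hlam hγ, ← EReal.coe_add]
  refine (EReal.coe_lt_coe_iff.2 hlt).trans_le ?_
  rw [EReal.coe_add, robustObjective]
  refine add_le_add le_rfl ?_
  rw [← expectedQuadratic_multivariateGaussian (posSemidef_extremalCovariance hlam hγ.1)]
  exact le_iSup₂ (f := fun Q (_ : Q ∈ ambiguitySet ρ (spectralSum lam v)) =>
    (expectedQuadratic Q Y : EReal)) _ (extremal_mem_ambiguitySet hρ hv hlam hγ)

/-- The residual of the stationarity condition `(γ I - X) √S* = γ √Sig`. -/
def dualResidual (γ₀ : ℝ) (lam : Fin p → ℝ) (v : Fin p → EuclideanSpace ℝ (Fin p))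
    (z : Matrix (Fin p) (Fin p) ℝ × ℝ) : Matrix (Fin p) (Fin p) ℝ :=
  (z.2 • (1 : Matrix (Fin p) (Fin p) ℝ) - z.1) * extremalRoot γ₀ lam v -
    z.2 • spectralSum (fun i => Real.sqrt (lam i)) v

/-- Replacing ρ² by Tr (√S* - √Sig)² makes the completed square applicable. -/
lemma convexObjective_eq (hv : Orthonormal ℝ v) (hlam : ∀ i, 0 ≤ lam i)
    (hγ : SolvesDualEquation ρ lam γ) {z : Matrix (Fin p) (Fin p) ℝ × ℝ}
    (hz : z ∈ convexFeasible p) :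
    convexObjective ρ (spectralSum lam v) z =
      -Real.log z.1.det + (extremalCovariance γ lam v * z.1).trace +
        ((dualResidual γ lam v z)ᵀ * (z.2 • (1 : Matrix (Fin p) (Fin p) ℝ) - z.1)⁻¹ *
          dualResidual γ lam v z).trace := by
  have h := dual_objective_eq (A := extremalRoot γ lam v)
    (B := spectralSum (fun i => Real.sqrt (lam i)) v) (spectralSum_transpose _)
    (spectralSum_transpose _) hz.2
  have hB : spectralSum (fun i => Real.sqrt (lam i)) v *
      spectralSum (fun i => Real.sqrt (lam i)) v = spectralSum lam v := by
    rw [spectralSum_mul hv]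
    exact congrArg (spectralSum · v) (funext fun i => Real.mul_self_sqrt (hlam i))
  rw [trace_sq_sub_extremalRoot hv hlam hγ, hB, extremalRoot_mul_self hv hlam hγ.1] at h
  rw [convexObjective, dualResidual]
  linarith

lemma dualResidual_estimator (hv : Orthonormal ℝ v) (γ₀ γ : ℝ) :
    dualResidual γ₀ lam v (estimator γ₀ lam v, γ) =
      spectralSum (fun i => (γ - estimatorEigenvalue γ₀ (lam i)) *
        Real.sqrt (extremalEigenvalue γ₀ (lam i)) - γ * Real.sqrt (lam i)) v := by
  simp only [dualResidual]
  rw [smul_one_eq_spectralSum hv, estimator, spectralSum_sub, extremalRoot, spectralSum_mul hv,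
    smul_spectralSum, spectralSum_sub]

/-- With X fixed at X*, the residual is linear in γ' and vanishes only at γ' = γ, which gives
uniqueness of the dual variable. -/
lemma dualResidual_estimator_entry (hγ : 0 < γ) {l : ℝ} (hl : 0 ≤ l) (γ' : ℝ) :
    (γ' - estimatorEigenvalue γ l) * Real.sqrt (extremalEigenvalue γ l) - γ' * Real.sqrt l =
      (γ' - γ) * (1 - sqrtRatio γ l) * Real.sqrt (extremalEigenvalue γ l) := by
  rw [sqrt_eq_sqrtRatio_mul hγ hl, estimatorEigenvalue_eq]
  ring

lemma trace_residual_nonneg {n : Type*} [Fintype n] [DecidableEq n] {D : Matrix n n ℝ}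
    (hD : D.PosDef) (M : Matrix n n ℝ) : 0 ≤ (Mᵀ * D⁻¹ * M).trace := by
  have := (hD.inv.posSemidef.conjTranspose_mul_mul_same M).trace_nonneg
  rwa [Matrix.conjTranspose_eq_transpose_of_trivial] at this

lemma isUniqueConvexMinimizer_estimator (hp : 0 < p) (hv : Orthonormal ℝ v)
    (hlam : ∀ i, 0 < lam i) (hγ : SolvesDualEquation ρ lam γ) :
    IsUniqueConvexMinimizer ρ (spectralSum lam v) (estimator γ lam v, γ) := by
  have hlam' := fun i => (hlam i).le
  have hγ0 := hγ.1
  -- Strictness of γI ≻ X* amounts to u > 0 for every eigenvalue, hence the need for a nonsingular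
  -- covariance.
  have hfeas : (estimator γ lam v, γ) ∈ convexFeasible p := by
    refine ⟨posDef_estimator hv hlam' hγ0, ?_⟩
    simp only
    rw [smul_one_eq_spectralSum hv, estimator, spectralSum_sub]
    refine posDef_spectralSum hv fun i => ?_
    have := mul_pos hγ0 (sqrtRatio_pos hγ0 (hlam i))
    rw [estimatorEigenvalue_eq]
    linarith
  have htr : (extremalCovariance γ lam v * estimator γ lam v).trace = p := by
    rw [extremalCovariance_mul_estimator hv hlam' hγ0, Matrix.trace_one, Fintype.card_fin]
  have hres : dualResidual γ lam v (estimator γ lam v, γ) = 0 := by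
    rw [dualResidual_estimator hv]
    simp only [dualResidual_estimator_entry hγ0 (hlam' _)]
    simp [spectralSum]
  refine ⟨hfeas, ?_⟩
  rintro ⟨Y, γ'⟩ hw hne
  rw [convexObjective_eq hv hlam' hγ hfeas, convexObjective_eq hv hlam' hγ hw, hres, htr]
  simp only [Matrix.mul_zero, Matrix.trace_zero, add_zero]
  -- Strictness comes from the residual if Y = X*, and from the log-determinant otherwise.
  by_cases hY : Y = estimator γ lam v
  · subst hY
    have hγ' : γ' - γ ≠ 0 := fun h => hne (by rw [sub_eq_zero.1 h])
    rw [htr]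
    refine lt_add_of_pos_right _ ?_
    have hD := hw.2
    simp only at hD
    rw [smul_one_eq_spectralSum hv, estimator, spectralSum_sub] at hD ⊢
    have hd := pos_of_posDef_spectralSum hv hD
    rw [← estimator, dualResidual_estimator hv, spectralSum_transpose,
      spectralSum_inv hv fun i => (hd i).ne', spectralSum_mul hv, spectralSum_mul hv,
      trace_spectralSum hv]
    simp only [dualResidual_estimator_entry hγ0 (hlam' _)]
    have : Nonempty (Fin p) := ⟨⟨0, hp⟩⟩
    refine Finset.sum_pos (fun i _ => ?_) Finset.univ_nonempty
    have h1 : 1 - sqrtRatio γ (lam i) ≠ 0 := (sub_pos.2 (sqrtRatio_lt_one hγ0.le (hlam' i))).ne'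
    have h2 := (Real.sqrt_pos.2 (extremalEigenvalue_pos hγ0 (hlam' i))).ne'
    have h3 := mul_pos (inv_pos.2 (hd i)) (mul_self_pos.2 (mul_ne_zero (mul_ne_zero hγ' h1) h2))
    linarith
  · have h1 := neg_log_det_estimator_add_lt hv hlam' hγ0 hw.1 hY
    have h2 := trace_residual_nonneg hw.2 (dualResidual γ lam v (Y, γ'))
    simp only at h1 h2 ⊢
    linarith

end SaddlePoint

end WassersteinShrinkage

end

theorem corollary5p2 {p : ℕ} (hp : 0 < p) (ρ : ℝ) (hρ : 0 < ρ)
    (Sig : Matrix (Fin p) (Fin p) ℝ) (hSig : Sig.PosSemidef)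
    (lam : Fin p → ℝ) (v : Fin p → EuclideanSpace ℝ (Fin p)) (hv : Orthonormal ℝ v)
    (hdecomp : Sig = WassersteinShrinkage.spectralSum lam v) :
    (∃! γ : ℝ, WassersteinShrinkage.SolvesDualEquation ρ lam γ) ∧
    ∀ γ : ℝ, WassersteinShrinkage.SolvesDualEquation ρ lam γ →
      WassersteinShrinkage.IsUniqueRobustMinimizer ρ Sig
        (WassersteinShrinkage.estimator γ lam v) ∧
      (Sig.PosDef → WassersteinShrinkage.IsUniqueConvexMinimizer ρ Sig
        (WassersteinShrinkage.estimator γ lam v, γ)) ∧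
      (WassersteinShrinkage.extremalCovariance γ lam v).PosSemidef ∧
      WassersteinShrinkage.AttainsWorstCase ρ Sig (WassersteinShrinkage.estimator γ lam v)
        (multivariateGaussian 0 (WassersteinShrinkage.extremalCovariance γ lam v)) := by
  subst hdecomp
  have hlam := WassersteinShrinkage.nonneg_of_posSemidef_spectralSum hv hSig
  refine ⟨WassersteinShrinkage.existsUnique_solvesDualEquation hp hρ hlam,
    fun γ hγ => ⟨?_, ?_, ?_, ?_⟩⟩
  · exact WassersteinShrinkage.isUniqueRobustMinimizer_estimator hρ hv hlam hγ
  · exact fun hpd => WassersteinShrinkage.isUniqueConvexMinimizer_estimator hp hv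
      (WassersteinShrinkage.pos_of_posDef_spectralSum hv hpd) hγ
  · exact WassersteinShrinkage.posSemidef_extremalCovariance hlam hγ.1
  · exact WassersteinShrinkage.attainsWorstCase_extremal hρ hv hlam hγ
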